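/- An infinite binary sequence is a map $\sigma:\mathbb N\to\{0,1\}$. A finite-state transducer (FST) is a tuple $T=(Q,q_0,\delta,\lambda)$ with a finite set $Q$ of states, an initial state $q_0\in Q$, a transition function $\delta:Q\times\{0,1\}\to Q$ and an output function $\lambda:Q\times\{0,1\}\to\{0,1\}^*$. Extend both to finite words by $\delta(q,\varepsilon)=q$, $\delta(q,au)=\delta(\delta(q,a),u)$, $\lambda(q,\varepsilon)=\varepsilon$, $\lambda(q,au)=\lambda(q,a)\,\lambda(\delta(q,a),u)$. For infinite binary sequences $\sigma,\tau$, the sequence $\tau$ is a transduct of $\sigma$, written $\sigma\ge\tau$, if there is an FST $T$ such that the words $\lambda(q_0,\sigma(0)\cdots\sigma(n-1))$, $n\in\mathbb N$, are prefixes of $\tau$ of unbounded length. The relation $\ge$ is a preorder. Its equivalence classes $[\sigma]=\{\tau : \sigma\ge\tau \text{ and } \tau\ge\sigma\}$ are called (FST) degrees; they are partially ordered by $[\sigma]\ge[\tau]$ iff $\sigma\ge\tau$. There is a least degree $\mathbf 0$, which consists of exactly the ultimately periodic sequences. A degree $D$ is an atom if $D\neq\mathbf 0$ and there is no degree strictly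 between $\mathbf 0$ and $D$. **Theorem.** Let $\langle n^2\rangle = 1\,0^{0}\,1\,0^{1}\,1\,0^{4}\,1\,0^{9}\,1\,0^{16}\cdots$ be the concatenation of the words $1\,0^{n^2}$ for $n=0,1,2,\dots$. The degree $[\langle n^2\rangle]$ is an atom. That is, $[\langle n^2\rangle]\neq\mathbf 0$, and every transduct of $\langle n^2\rangle$ that is not ultimately periodic can be transduced back to $\langle n^2\rangle$. -/

import Mathlib

/-- A finite-state transducer over the binary alphabet (`true` is the letter 1, `false` is the
letter 0): complete, sequential, with word output. -/
structure FST where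
  /-- the set of states -/
  Q : Type
  /-- there are finitely many states -/
  finite_Q : Finite Q
  /-- the initial state -/
  init : Q
  /-- the transition function -/
  step : Q → Bool → Q
  /-- the output function -/
  out : Q → Bool → List Bool

namespace FST

/-- The transition function extended to finite words. -/
def run (T : FST) : T.Q → List Bool → T.Q
  | q, [] => q
  | q, a :: u => T.run (T.step q a) u

/-- The output function extended to finite words. -/
def output (T : FST) : T.Q → List Bool → List Bool
  | _, [] => []
  | q, a :: u => T.out q a ++ T.output (T.step q a) u

end FST

/-- The prefix of length `n` of an infinite binary sequence. -/
def seqPrefix (σ : ℕ → Bool) (n : ℕ) : List Bool := (List.range n).map σ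

/-- `T` transduces the infinite sequence `σ` to the infinite sequence `τ`: the outputs of `T` on
the prefixes of `σ` are prefixes of `τ`, of unbounded length. That is, `T(σ) = τ`, where `T(σ)` is
the limit of the outputs on the finite prefixes of `σ`. -/
def FST.Transduces (T : FST) (σ τ : ℕ → Bool) : Prop :=
  (∀ n, T.output T.init (seqPrefix σ n)
      = seqPrefix τ (T.output T.init (seqPrefix σ n)).length) ∧
  (∀ m, ∃ n, m ≤ (T.output T.init (seqPrefix σ n)).length)

/-- `τ` is a transduct of `σ` (written `σ ≥ τ` in the literature). -/
def Transducible (σ τ : ℕ → Bool) : Prop := ∃ T : FST, T.Transduces σ τ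

/-- Ultimate periodicity of a function on the natural numbers. -/
def UltimatelyPeriodic {A : Type*} (f : ℕ → A) : Prop :=
  ∃ n₀ p : ℕ, 0 < p ∧ ∀ n ≥ n₀, f (n + p) = f n

/-- The infinite sequence `1 0^{f 0} 1 0^{f 1} 1 0^{f 2} ⋯`. Its letter at position `n` is read off
from the concatenation of the first `n + 1` blocks, a word of length at least `n + 1`. -/
def blockSeq (f : ℕ → ℕ) (n : ℕ) : Bool :=
  ((List.range (n + 1)).flatMap fun i => true :: List.replicate (f i) false).getD n false

/-! ### Transducibility is a preorder -/

theorem length_seqPrefix (σ : ℕ → Bool) (n : ℕ) : (seqPrefix σ n).length = n := by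
  simp [seqPrefix]

theorem seqPrefix_succ (σ : ℕ → Bool) (n : ℕ) :
    seqPrefix σ (n + 1) = seqPrefix σ n ++ [σ n] := by
  simp [seqPrefix, List.range_succ]

theorem seqPrefix_add (σ : ℕ → Bool) (n k : ℕ) :
    ∃ u, seqPrefix σ (n + k) = seqPrefix σ n ++ u := by
  induction k with
  | zero => exact ⟨[], by simp⟩
  | succ k ih =>
    obtain ⟨u, hu⟩ := ih
    exact ⟨u ++ [σ (n + k)], by rw [← Nat.add_assoc, seqPrefix_succ, hu, List.append_assoc]⟩

theorem FST.output_append (T : FST) (u v : List Bool) (q : T.Q) :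
    T.output q (u ++ v) = T.output q u ++ T.output (T.run q u) v := by
  induction u generalizing q with
  | nil => rfl
  | cons a u ih => simp [FST.output, FST.run, ih]

theorem FST.run_append (T : FST) (u v : List Bool) (q : T.Q) :
    T.run q (u ++ v) = T.run (T.run q u) v := by
  induction u generalizing q with
  | nil => rfl
  | cons a u ih => simp [FST.run, ih]

/-- The composition of two transducers, which feeds the output of `T` to `S`. -/
def FST.comp (T S : FST) : FST where
  Q := T.Q × S.Q
  finite_Q := by
    have := T.finite_Q
    have := S.finite_Q
    infer_instance
  init := (T.init, S.init)
  step p a := (T.step p.1 a, S.run p.2 (T.out p.1 a))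
  out p a := S.output p.2 (T.out p.1 a)

theorem FST.comp_output (T S : FST) (u : List Bool) (p : T.Q) (q : S.Q) :
    (T.comp S).output (p, q) u = S.output q (T.output p u) := by
  induction u generalizing p q with
  | nil => rfl
  | cons a u ih =>
    have h := ih (T.step p a) (S.run q (T.out p a))
    simp only [FST.output, FST.output_append]
    rw [← h]
    rfl

theorem Transducible.refl (σ : ℕ → Bool) : Transducible σ σ := by
  let T : FST := ⟨Unit, inferInstance, (), fun _ _ => (), fun _ a => [a]⟩
  have h : ∀ u : List Bool, T.output () u = u := by
    intro u
    induction u with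
    | nil => rfl
    | cons a u ih =>
      change [a] ++ T.output () u = a :: u
      rw [ih]
      rfl
  refine ⟨T, fun n => ?_, fun m => ⟨m, ?_⟩⟩
  · change T.output () _ = seqPrefix σ (T.output () _).length
    rw [h, length_seqPrefix]
  · change m ≤ (T.output () _).length
    rw [h, length_seqPrefix]

theorem Transducible.trans {σ τ ρ : ℕ → Bool} (h₁ : Transducible σ τ) (h₂ : Transducible τ ρ) :
    Transducible σ ρ := by
  obtain ⟨T, hT, hT'⟩ := h₁
  obtain ⟨S, hS, hS'⟩ := h₂
  refine ⟨T.comp S, fun n => ?_, fun m => ?_⟩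
  · change (T.comp S).output (T.init, S.init) _
      = seqPrefix ρ ((T.comp S).output (T.init, S.init) _).length
    rw [FST.comp_output, hT n]
    exact hS _
  · obtain ⟨k, hk⟩ := hS' m
    obtain ⟨n, hn⟩ := hT' k
    refine ⟨n, ?_⟩
    change m ≤ ((T.comp S).output (T.init, S.init) _).length
    rw [FST.comp_output, hT n]
    obtain ⟨d, hd⟩ := Nat.exists_eq_add_of_le hn
    obtain ⟨u, hu⟩ := seqPrefix_add τ k d
    rw [hd, hu, FST.output_append, List.length_append]
    omega

/-! ### The partial order of degrees -/

/-- Two sequences are equivalent when each is a transduct of the other. -/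
def fstSetoid : Setoid (ℕ → Bool) where
  r σ τ := Transducible σ τ ∧ Transducible τ σ
  iseqv :=
    { refl := fun σ => ⟨.refl σ, .refl σ⟩
      symm := fun h => ⟨h.2, h.1⟩
      trans := fun h k => ⟨h.1.trans k.1, k.2.trans h.2⟩ }

/-- The FST degrees: equivalence classes of infinite binary sequences. -/
def FSTDegree : Type := Quotient fstSetoid

/-- The degree of a sequence. -/
def fstDegree (σ : ℕ → Bool) : FSTDegree := Quotient.mk fstSetoid σ

/-- The order on degrees: the degree of `τ` is below the degree of `σ` when `τ` is a transduct
of `σ`. -/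
instance : PartialOrder FSTDegree where
  le := Quotient.lift₂ (s₁ := fstSetoid) (s₂ := fstSetoid) (fun τ σ => Transducible σ τ)
    (fun _ _ _ _ h k => propext
      ⟨fun t => (k.2.trans t).trans h.1, fun t => (k.1.trans t).trans h.2⟩)
  le_refl a := Quotient.inductionOn a (s := fstSetoid) fun σ => Transducible.refl σ
  le_trans a b c := Quotient.inductionOn₃ a b c
    (s₁ := fstSetoid) (s₂ := fstSetoid) (s₃ := fstSetoid) fun _ _ _ h k => Transducible.trans k h
  le_antisymm a b := Quotient.inductionOn₂ a b (s₁ := fstSetoid) (s₂ := fstSetoid)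
    fun _ _ h k => Quotient.sound (s := fstSetoid) ⟨k, h⟩

theorem fstDegree_le_iff {σ τ : ℕ → Bool} :
    fstDegree τ ≤ fstDegree σ ↔ Transducible σ τ := Iff.rfl

theorem fstDegree_eq_iff {σ τ : ℕ → Bool} :
    fstDegree σ = fstDegree τ ↔ Transducible σ τ ∧ Transducible τ σ :=
  Quotient.eq (r := fstSetoid)

/-- Every sequence can be transduced to every ultimately periodic sequence. -/
theorem UltimatelyPeriodic.transducible {τ : ℕ → Bool} (h : UltimatelyPeriodic τ)
    (σ : ℕ → Bool) : Transducible σ τ := by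
  obtain ⟨n₀, p, hp, hper⟩ := h
  let nxt : ℕ → ℕ := fun k => if k + 1 < n₀ + p then k + 1 else n₀
  have hnxt : ∀ k, nxt k < n₀ + p := by
    intro k
    simp only [nxt]
    split_ifs <;> omega
  have hτ : ∀ k, k < n₀ + p → ∀ j, (∀ i, τ (j + i) = τ (k + i)) →
      ∀ i, τ (j + 1 + i) = τ (nxt k + i) := by
    intro k hk j hj i
    have h1 := hj (1 + i)
    rw [← Nat.add_assoc, ← Nat.add_assoc] at h1
    rw [h1]
    simp only [nxt]
    split_ifs with hlt
    · rfl
    · rw [show k + 1 + i = (n₀ + i) + p by omega]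
      exact hper _ (by omega)
  let T : FST := ⟨Fin (n₀ + p), inferInstance, ⟨0, by omega⟩,
    fun q _ => ⟨nxt q, hnxt q⟩, fun q _ => [τ q]⟩
  have key : ∀ n, (∀ i, τ (n + i) = τ ((T.run T.init (seqPrefix σ n) : Fin (n₀ + p)).1 + i)) ∧
      T.output T.init (seqPrefix σ n) = seqPrefix τ n := by
    intro n
    induction n with
    | zero => exact ⟨fun i => rfl, rfl⟩
    | succ n ih =>
      obtain ⟨ih1, ih2⟩ := ih
      rw [seqPrefix_succ, FST.run_append, FST.output_append, seqPrefix_succ, ih2]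
      refine ⟨hτ _ (T.run T.init (seqPrefix σ n) : Fin (n₀ + p)).2 n ih1, ?_⟩
      congr 1
      change [τ (T.run T.init (seqPrefix σ n) : Fin (n₀ + p)).1] = _
      have := ih1 0
      simp only [Nat.add_zero] at this
      rw [this]
  refine ⟨T, fun n => ?_, fun m => ⟨m, ?_⟩⟩
  · rw [(key n).2, length_seqPrefix]
  · rw [(key m).2, length_seqPrefix]

/-- The bottom degree `0`, the degree of the sequence `000⋯`. -/
instance : OrderBot FSTDegree where
  bot := fstDegree fun _ => false
  bot_le a := Quotient.inductionOn a (s := fstSetoid) fun σ =>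
    UltimatelyPeriodic.transducible ⟨0, 1, Nat.one_pos, fun _ _ => rfl⟩ σ

/-- The transducts of the sequence `000⋯` are ultimately periodic. -/
theorem ultimatelyPeriodic_of_transducible {τ : ℕ → Bool}
    (h : Transducible (fun _ => false) τ) : UltimatelyPeriodic τ := by
  obtain ⟨T, hT, hT'⟩ := h
  have := T.finite_Q
  set q : ℕ → T.Q := fun n => T.run T.init (seqPrefix (fun _ => false) n) with hq
  set L : ℕ → ℕ := fun n => (T.output T.init (seqPrefix (fun _ => false) n)).length with hL
  have hqs : ∀ n, q (n + 1) = T.step (q n) false := by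
    intro n
    simp only [hq, seqPrefix_succ, FST.run_append]
    rfl
  have hout : ∀ n, seqPrefix τ (L (n + 1)) = seqPrefix τ (L n) ++ T.out (q n) false := by
    intro n
    rw [← hT n, ← hT (n + 1), seqPrefix_succ, FST.output_append]
    simp [FST.output, hq]
  have hLs : ∀ n, L (n + 1) = L n + (T.out (q n) false).length := by
    intro n
    have := congrArg List.length (hout n)
    simpa [length_seqPrefix] using this
  obtain ⟨N, M, hne, hNM⟩ := Finite.exists_ne_map_eq_of_infinite q
  wlog hlt : N < M generalizing N M
  · exact this M N hne.symm hNM.symm (by omega)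
  obtain ⟨P, rfl⟩ := Nat.exists_eq_add_of_le hlt.le
  have hper : ∀ i, q (N + i + P) = q (N + i) := by
    intro i
    induction i with
    | zero => simpa using hNM.symm
    | succ i ih =>
      rw [show N + (i + 1) + P = (N + i + P) + 1 by omega, ← Nat.add_assoc, hqs, hqs, ih]
  obtain ⟨c, hc⟩ : ∃ c, L (N + P) = L N + c := by
    apply Nat.exists_eq_add_of_le
    exact monotone_nat_of_le_succ (f := L) (fun n => by rw [hLs]; omega) (by omega)
  have hLc : ∀ i, L (N + i + P) = L (N + i) + c := by
    intro i
    induction i with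
    | zero => simpa using hc
    | succ i ih =>
      rw [show N + (i + 1) + P = (N + i + P) + 1 by omega, ← Nat.add_assoc, hLs, hLs, ih, hper]
      omega
  have hmono : Monotone L := monotone_nat_of_le_succ fun n => by rw [hLs]; omega
  have hcpos : 0 < c := by
    by_contra h0
    have hc0 : c = 0 := by omega
    have hb : ∀ j, L (N + j * P) = L N := by
      intro j
      induction j with
      | zero => simp
      | succ j ih =>
        have := hLc (j * P)
        rw [show N + (j + 1) * P = N + j * P + P by ring, this, ih, hc0, Nat.add_zero]
    obtain ⟨n, hn⟩ := hT' (L N + 1)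
    have h1 : L n ≤ L (N + n * P) := hmono (by nlinarith)
    rw [hb] at h1
    change L N + 1 ≤ L n at hn
    omega
  have hget : ∀ n i (hi : i < (T.out (q n) false).length),
      τ (L n + i) = (T.out (q n) false)[i] := by
    intro n i hi
    have h1 : (seqPrefix τ (L (n + 1)))[L n + i]? = some (τ (L n + i)) := by
      have : L n + i < L (n + 1) := by rw [hLs]; omega
      simp [seqPrefix, this]
    rw [hout, List.getElem?_append_right (by rw [length_seqPrefix]; omega), length_seqPrefix,
      Nat.add_sub_cancel_left, List.getElem?_eq_getElem hi] at h1
    exact (Option.some.inj h1).symm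
  refine ⟨L N, c, hcpos, fun k hk => ?_⟩
  have hex : ∃ i, k < L (N + i + 1) := by
    obtain ⟨n, hn⟩ := hT' (k + 1)
    exact ⟨n, lt_of_lt_of_le hn (hmono (by omega))⟩
  classical
  obtain ⟨i, hi, hmin⟩ : ∃ i, k < L (N + i + 1) ∧ L (N + i) ≤ k := by
    refine ⟨Nat.find hex, Nat.find_spec hex, ?_⟩
    rcases hz : Nat.find hex with _ | j
    · simpa using hk
    · have := Nat.find_min hex (m := j) (by omega)
      simpa [Nat.add_assoc] using this
  obtain ⟨j, rfl⟩ := Nat.exists_eq_add_of_le hmin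
  have hj : j < (T.out (q (N + i)) false).length := by rw [hLs] at hi; omega
  have hj' : j < (T.out (q (N + i + P)) false).length := by rw [hper]; exact hj
  rw [show L (N + i) + j + c = L (N + i + P) + j by rw [hLc]; omega, hget _ _ hj', hget _ _ hj]
  simp only [hper]

/-- The bottom degree consists of exactly the ultimately periodic sequences. -/
theorem fstDegree_eq_bot_iff {σ : ℕ → Bool} : fstDegree σ = ⊥ ↔ UltimatelyPeriodic σ := by
  constructor
  · intro h
    exact ultimatelyPeriodic_of_transducible (fstDegree_eq_iff.1 h).2
  · intro h
    exact le_antisymm (h.transducible _) bot_le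

/-! Let `T` transduce `⟨n²⟩` to `τ`. After enough zeros `T` moves on a cycle of states, where its
output is periodic. Cutting the input `S` zeros before the end of each block cuts `τ` into pieces: a
bounded head, then a tail of period dividing a fixed `L`. Because `n²` modulo `Z` is periodic in
`n`, the states at the cuts are ultimately periodic, with a period `N` divisible by `Z`. Piece `n +
N` therefore prolongs piece `n`, by an amount linear in `n`.

Compare `τ` with its shift by `L` (`mismatch`). Mismatches occur only in the heads, and from some
point on each round of `N` pieces contains the same number `K` of them. If `τ` is not ultimately
periodic, then mismatches never stop, and keeping every `K`-th one gives a block sequence whose gaps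
form a quadratic polynomial in the index of the round
(`ultimatelyPeriodic_or_transducible_squares`). The leading coefficient is positive, since otherwise
all rounds have equal length and `τ` is ultimately periodic.

It remains to normalise a quadratic polynomial to `n²` (`blockSeq_quadratic_transducible_squares`):
a suitable weighted sum of two consecutive blocks completes the square, and a finite counter can
divide by the leading coefficient and subtract the constant. `FST.Transduces.squares` supplies the
pieces. -/

namespace FST

theorem run_cons (T : FST) (q : T.Q) (x : Bool) (u : List Bool) :
    T.run q (x :: u) = T.run (T.step q x) u := rfl

theorem output_cons (T : FST) (q : T.Q) (x : Bool) (u : List Bool) :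
    T.output q (x :: u) = T.out q x ++ T.output (T.step q x) u := rfl

end FST

/-! ### Transducers given by their trajectory -/

theorem getElem?_seqPrefix (σ : ℕ → Bool) {n k : ℕ} (h : k < n) :
    (seqPrefix σ n)[k]? = some (σ k) := by
  simp [seqPrefix, h]

theorem eq_seqPrefix_of_getElem? {σ : ℕ → Bool} {u : List Bool}
    (h : ∀ k < u.length, u[k]? = some (σ k)) : u = seqPrefix σ u.length := by
  refine List.ext_getElem? fun k => ?_
  by_cases hk : k < u.length
  · rw [h k hk, getElem?_seqPrefix σ hk]
  · rw [List.getElem?_eq_none (by omega),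
      List.getElem?_eq_none (by rw [length_seqPrefix]; omega)]

/-- A machine whose trajectory along the input visits finitely many states transduces. -/
theorem transducible_of_trajectory {S : Type} {σ τ : ℕ → Bool} (x : ℕ → S)
    (hfin : (Set.range x).Finite) (step : S → Bool → S) (out : S → Bool → List Bool)
    (hstep : ∀ m, x (m + 1) = step (x m) (σ m)) (l : ℕ → ℕ) (l0 : l 0 = 0)
    (hout : ∀ m, seqPrefix τ (l (m + 1)) = seqPrefix τ (l m) ++ out (x m) (σ m))
    (hl : ∀ m, ∃ n, m ≤ l n) : Transducible σ τ := by
  classical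
  let T : FST :=
    { Q := Set.range x
      finite_Q := hfin
      init := ⟨x 0, 0, rfl⟩
      -- The default `q` is never used along `σ`; it only makes the machine complete.
      step := fun q a => if h : step q.1 a ∈ Set.range x then ⟨_, h⟩ else q
      out := fun q a => out q.1 a }
  have key : ∀ m, T.run T.init (seqPrefix σ m) = (⟨x m, m, rfl⟩ : Set.range x) ∧
      T.output T.init (seqPrefix σ m) = seqPrefix τ (l m) := by
    intro m
    induction m with
    | zero => exact ⟨rfl, by rw [l0]; rfl⟩
    | succ m ih =>
      rw [seqPrefix_succ, FST.run_append, FST.output_append, ih.1, ih.2, hout]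
      refine ⟨?_, ?_⟩
      · have hm : step (x m) (σ m) ∈ Set.range x := ⟨m + 1, hstep m⟩
        change (if h : step (x m) (σ m) ∈ Set.range x then
          (⟨_, h⟩ : Set.range x) else ⟨x m, m, rfl⟩) = _
        rw [dif_pos hm]
        exact Subtype.ext (hstep m).symm
      · congr 1
        exact List.append_nil _
  refine ⟨T, fun n => ?_, fun m => ?_⟩
  · rw [(key n).2, length_seqPrefix]
  · obtain ⟨n, hn⟩ := hl m
    exact ⟨n, by rw [(key n).2, length_seqPrefix]; exact hn⟩

theorem transducible_of_letterwise {S : Type} {σ τ : ℕ → Bool} (x : ℕ → S)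
    (hfin : (Set.range x).Finite) (step : S → Bool → S) (out : S → Bool → Bool)
    (hstep : ∀ m, x (m + 1) = step (x m) (σ m)) (hout : ∀ m, τ m = out (x m) (σ m)) :
    Transducible σ τ :=
  transducible_of_trajectory x hfin step (fun s a => [out s a]) hstep id rfl
    (fun m => by rw [id, id, seqPrefix_succ, hout]) fun m => ⟨m, le_rfl⟩

theorem transducible_drop (σ : ℕ → Bool) (k : ℕ) : Transducible σ fun m => σ (k + m) := by
  refine transducible_of_trajectory (fun m => min m k)
    ((Set.finite_Iic k).subset (by rintro _ ⟨m, rfl⟩; simp))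
    (fun s _ => min (s + 1) k) (fun s a => if s < k then [] else [a])
    (fun m => by omega) (fun m => m - k) (by simp) (fun m => ?_) fun m => ⟨m + k, by simp⟩
  by_cases h : m < k
  · rw [if_pos (by omega), List.append_nil, show m + 1 - k = m - k by omega]
  · rw [if_neg (by omega), show m + 1 - k = (m - k) + 1 by omega, seqPrefix_succ,
      show k + (m - k) = m by omega]

theorem transducible_prepend (σ : ℕ → Bool) (k : ℕ) :
    Transducible (fun m => σ (k + m)) σ := by
  refine transducible_of_trajectory (fun m => decide (m = 0)) (Set.toFinite _)
    (fun _ _ => false) (fun s a => if s then seqPrefix σ k ++ [a] else [a])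
    (fun m => by simp) (fun m => if m = 0 then 0 else k + m) rfl (fun m => ?_)
    fun m => ⟨m + 1, by simp; omega⟩
  rcases m with _ | m
  · simp [seqPrefix_succ]; rfl
  · simp [seqPrefix_succ, ← Nat.add_assoc]

/-! ### Block sequences -/

/-- The word `1 0^{f 0} ⋯ 1 0^{f (n - 1)}`. -/
def blockPrefix (f : ℕ → ℕ) (n : ℕ) : List Bool :=
  (List.range n).flatMap fun i => true :: List.replicate (f i) false

/-- The position at which the `n`-th block of `blockSeq f` starts. -/
def blockPos (f : ℕ → ℕ) (n : ℕ) : ℕ := ∑ i ∈ Finset.range n, (f i + 1)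

theorem blockPos_succ (f : ℕ → ℕ) (n : ℕ) : blockPos f (n + 1) = blockPos f n + (f n + 1) :=
  Finset.sum_range_succ _ _

theorem blockPos_add (f : ℕ → ℕ) (v n : ℕ) :
    blockPos f (v + n) = blockPos f v + blockPos (fun i => f (v + i)) n :=
  Finset.sum_range_add _ _ _

theorem le_blockPos (f : ℕ → ℕ) (n : ℕ) : n ≤ blockPos f n := by
  induction n with
  | zero => simp
  | succ n ih => rw [blockPos_succ]; omega

theorem blockPrefix_succ (f : ℕ → ℕ) (n : ℕ) :
    blockPrefix f (n + 1) = blockPrefix f n ++ true :: List.replicate (f n) false := by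
  simp [blockPrefix, List.range_succ]

theorem length_blockPrefix (f : ℕ → ℕ) (n : ℕ) : (blockPrefix f n).length = blockPos f n := by
  induction n with
  | zero => rfl
  | succ n ih => rw [blockPrefix_succ, blockPos_succ]; simp [ih]

theorem blockPrefix_prefix (f : ℕ → ℕ) {m n : ℕ} (h : m ≤ n) :
    blockPrefix f m <+: blockPrefix f n := by
  induction n, h using Nat.le_induction with
  | base => exact List.prefix_rfl
  | succ n _ ih => exact ih.trans ⟨_, (blockPrefix_succ f n).symm⟩

theorem getElem?_blockPrefix (f : ℕ → ℕ) {n m : ℕ} (h : m < blockPos f n) :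
    (blockPrefix f n)[m]? = some (blockSeq f m) := by
  have h1 : m < (blockPrefix f (m + 1)).length := by
    rw [length_blockPrefix]; exact le_blockPos f (m + 1)
  have h2 : (blockPrefix f (m + 1))[m]? = some (blockSeq f m) := by
    rw [List.getElem?_eq_getElem h1]
    change _ = some ((blockPrefix f (m + 1)).getD m false)
    rw [List.getD_eq_getElem _ _ h1]
  rw [← h2]
  rcases le_total n (m + 1) with hn | hn
  · obtain ⟨t, ht⟩ := blockPrefix_prefix f hn
    rw [← ht, List.getElem?_append_left (by rwa [length_blockPrefix])]
  · obtain ⟨t, ht⟩ := blockPrefix_prefix f hn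
    rw [← ht, List.getElem?_append_left h1]

theorem blockPrefix_eq_seqPrefix (f : ℕ → ℕ) (n : ℕ) :
    blockPrefix f n = seqPrefix (blockSeq f) (blockPos f n) := by
  rw [← length_blockPrefix]
  exact eq_seqPrefix_of_getElem? fun k hk =>
    getElem?_blockPrefix f (by rwa [length_blockPrefix] at hk)

theorem blockSeq_blockPos_add (f : ℕ → ℕ) {i k : ℕ} (h : k ≤ f i) :
    blockSeq f (blockPos f i + k) = decide (k = 0) := by
  have h1 : blockPos f i + k < blockPos f (i + 1) := by rw [blockPos_succ]; omega
  have h2 := getElem?_blockPrefix f h1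
  rw [blockPrefix_succ, List.getElem?_append_right (by rw [length_blockPrefix]; omega),
    length_blockPrefix, Nat.add_sub_cancel_left] at h2
  rcases k with _ | k
  · simpa using h2.symm
  · rw [List.getElem?_cons_succ, List.getElem?_replicate, if_pos (by omega)] at h2
    simpa using h2.symm

/-- Every number lies in one of the consecutive intervals cut out by an unbounded sequence. -/
theorem exists_interval_of_unbounded {a : ℕ → ℕ} (hub : ∀ m, ∃ n, m ≤ a n) {n₀ m : ℕ}
    (hmono : ∀ n ≥ n₀, a n ≤ a (n + 1)) (hm : a n₀ ≤ m) :
    ∃ n ≥ n₀, a n ≤ m ∧ m < a (n + 1) := by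
  classical
  have hmono' : ∀ i j, a (n₀ + i) ≤ a (n₀ + i + j) := by
    intro i j
    induction j with
    | zero => exact le_rfl
    | succ j ih => exact ih.trans (hmono _ (by omega))
  have hex : ∃ i, m < a (n₀ + i) := by
    -- The sum dominates every `a i` with `i < n₀`, which forces `n₀ ≤ n`.
    obtain ⟨n, hn⟩ := hub (a n₀ + m + 1 + ∑ i ∈ Finset.range n₀, a i)
    have hn₀ : n₀ ≤ n := by
      by_contra hlt
      have := Finset.single_le_sum (f := a) (fun _ _ => Nat.zero_le _)
        (Finset.mem_range.2 (show n < n₀ by omega))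
      omega
    obtain ⟨j, rfl⟩ := Nat.exists_eq_add_of_le hn₀
    exact ⟨j, by omega⟩
  rcases hz : Nat.find hex with _ | j
  · have := Nat.find_spec hex
    rw [hz] at this
    exact absurd this (by simpa using hm)
  · have h1 := Nat.find_spec hex
    have h2 := Nat.find_min hex (m := j) (by omega)
    rw [hz] at h1
    exact ⟨n₀ + j, by omega, by omega, h1⟩

theorem exists_blockPos_add (f : ℕ → ℕ) (m : ℕ) : ∃ i k, k ≤ f i ∧ m = blockPos f i + k := by
  obtain ⟨i, -, h1, h2⟩ := exists_interval_of_unbounded (a := blockPos f) (n₀ := 0) (m := m)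
    (fun m => ⟨m, le_blockPos f m⟩) (fun n _ => by rw [blockPos_succ]; omega) (Nat.zero_le _)
  rw [blockPos_succ] at h2
  exact ⟨i, m - blockPos f i, by omega, by omega⟩

theorem eq_blockSeq {f : ℕ → ℕ} {σ : ℕ → Bool}
    (h : ∀ i k, k ≤ f i → σ (blockPos f i + k) = decide (k = 0)) : σ = blockSeq f := by
  funext m
  obtain ⟨i, k, hk, rfl⟩ := exists_blockPos_add f m
  rw [h i k hk, blockSeq_blockPos_add f hk]

theorem blockSeq_shift (f : ℕ → ℕ) (v : ℕ) :
    (fun m => blockSeq f (blockPos f v + m)) = blockSeq fun i => f (v + i) := by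
  refine eq_blockSeq fun i k hk => ?_
  rw [← Nat.add_assoc, ← blockPos_add, blockSeq_blockPos_add f hk]

theorem blockSeq_transducible_shift (f : ℕ → ℕ) (v : ℕ) :
    Transducible (blockSeq f) (blockSeq fun i => f (v + i)) := by
  rw [← blockSeq_shift]
  exact transducible_drop _ _

theorem blockSeq_shift_transducible (f : ℕ → ℕ) (v : ℕ) :
    Transducible (blockSeq fun i => f (v + i)) (blockSeq f) := by
  rw [← blockSeq_shift]
  exact transducible_prepend _ _

/-- A period `p` would repeat the 1 that opens a late block of at least `p` zeros inside these
zeros. -/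
theorem not_ultimatelyPeriodic_blockSeq {f : ℕ → ℕ} (hf : ∀ m, ∃ i ≥ m, m ≤ f i) :
    ¬ UltimatelyPeriodic (blockSeq f) := by
  rintro ⟨n₀, p, hp, h⟩
  obtain ⟨i, hi, hfi⟩ := hf (n₀ + p)
  have h1 := h (blockPos f i) ((le_blockPos f i).trans' (by omega))
  rw [blockSeq_blockPos_add f (show p ≤ f i by omega)] at h1
  have h2 := blockSeq_blockPos_add f (Nat.zero_le (f i))
  rw [Nat.add_zero] at h2
  rw [h2] at h1
  simp at h1
  omega

/-! ### Weighted sums of blocks -/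

/-- The remainder left in a counter of total weight `w` that emits one letter for every `D` units
in excess of `κ`. -/
def counterRem (κ D w : ℕ) : ℕ := w - D * ((w - κ) / D)

theorem counterRem_lt {κ D : ℕ} (hD : 0 < D) (w : ℕ) : counterRem κ D w < κ + D := by
  unfold counterRem
  have := Nat.div_add_mod (w - κ) D
  have := Nat.mod_lt (w - κ) hD
  omega

theorem counterRem_add_div {κ D : ℕ} (hD : 0 < D) (w a : ℕ) :
    (w + a - κ) / D = (w - κ) / D + (counterRem κ D w + a - κ) / D := by
  unfold counterRem
  have h1 := Nat.div_add_mod (w - κ) D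
  rcases le_total w κ with h | h
  · rw [Nat.sub_eq_zero_of_le h]; simp
  · set q := (w - κ) / D
    have e : w + a - κ = (w - D * q + a - κ) + D * q := by omega
    rw [e, Nat.add_mul_div_left _ _ hD]
    omega

/-- The bounded remainder determines its own update, so a finite-state machine can run the counter.
-/
theorem counterRem_add {κ D : ℕ} (hD : 0 < D) (w a : ℕ) :
    counterRem κ D (counterRem κ D w + a) = counterRem κ D (w + a) := by
  have h := counterRem_add_div (κ := κ) hD w a
  have h1 : D * ((w - κ) / D) ≤ w := by
    have := Nat.div_add_mod (w - κ) D
    omega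
  conv_rhs => unfold counterRem
  rw [h]
  unfold counterRem at h ⊢
  rw [Nat.mul_add]
  omega

/-- The transducer which replaces two consecutive blocks `1 0^x 1 0^y` by a single block
`1 0^z`, where `z` is a weighted sum of `x` and `y`. -/
def pairWeight (κ D e : ℕ) (a : Bool → ℕ) (hD : 0 < D) : FST where
  -- The flag is `false` in the first block of a pair and `true` in the second. It starts as `true`,
  -- so that the first 1 opens a pair.
  Q := Bool × Fin (κ + D)
  finite_Q := inferInstance
  init := (true, ⟨_, counterRem_lt hD 0⟩)
  step q x := if x && q.1 then (false, ⟨_, counterRem_lt hD (a false)⟩)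
    else (x || q.1, ⟨_, counterRem_lt hD (q.2 + a (x || q.1))⟩)
  out q x := if x && q.1 then true :: List.replicate (e + (a false - κ) / D) false
    else List.replicate ((q.2 + a (x || q.1) - κ) / D) false

section pairWeight

variable {κ D : ℕ} (e : ℕ) (a : Bool → ℕ) (hD : 0 < D)

/-- The state of `pairWeight` with total weight `w` accumulated. -/
def pairState (b : Bool) (w : ℕ) : (pairWeight κ D e a hD).Q := (b, ⟨_, counterRem_lt hD w⟩)

theorem pairWeight_zeros (b : Bool) (w k : ℕ) :
    (pairWeight κ D e a hD).run (pairState e a hD b w) (List.replicate k false) =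
      pairState e a hD b (w + k * a b) ∧
    (pairWeight κ D e a hD).output (pairState e a hD b w) (List.replicate k false) =
      List.replicate ((w + k * a b - κ) / D - (w - κ) / D) false := by
  induction k generalizing w with
  | zero => simp [FST.run, FST.output]
  | succ k ih =>
    have hs : (pairWeight κ D e a hD).step (pairState e a hD b w) false =
        pairState e a hD b (w + a b) := by
      refine Prod.ext rfl (Fin.ext ?_)
      exact counterRem_add hD w (a b)
    rw [List.replicate_succ]
    refine ⟨?_, ?_⟩
    · rw [FST.run_cons, hs, (ih _).1, show w + (k + 1) * a b = w + a b + k * a b by ring]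
    · rw [FST.output_cons, hs, (ih _).2]
      change List.replicate ((counterRem κ D w + a b - κ) / D) false ++ _ = _
      rw [List.replicate_append_replicate]
      congr 1
      have h1 := counterRem_add_div (κ := κ) hD w (a b)
      have h2 : (w + a b - κ) / D ≤ (w + a b + k * a b - κ) / D :=
        Nat.div_le_div_right (by omega)
      rw [show w + (k + 1) * a b = w + a b + k * a b by ring]
      generalize (w + a b - κ) / D = i at *
      generalize (w + a b + k * a b - κ) / D = j at *
      generalize (w - κ) / D = i' at *
      generalize (counterRem κ D w + a b - κ) / D = j' at *
      omega

/-- The letters emitted by the counter telescope to the total weight of the pair. The value `w₀`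
left by the previous pair is discarded at the opening 1. -/
theorem pairWeight_blocks (w₀ x y z : ℕ)
    (h : (x + 1) * a false + (y + 1) * a true = κ + D * z) :
    (∃ w₁, (pairWeight κ D e a hD).run (pairState e a hD true w₀) ((true :: List.replicate x false) ++
      (true :: List.replicate y false)) = pairState e a hD true w₁) ∧
    (pairWeight κ D e a hD).output (pairState e a hD true w₀) ((true :: List.replicate x false) ++
      (true :: List.replicate y false)) = true :: List.replicate (e + z) false := by
  have hs1 : (pairWeight κ D e a hD).step (pairState e a hD true w₀) true =
      pairState e a hD false (a false) := rfl
  have hs2 : ∀ w, (pairWeight κ D e a hD).step (pairState e a hD false w) true =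
      pairState e a hD true (w + a true) := by
    intro w
    refine Prod.ext rfl (Fin.ext ?_)
    exact counterRem_add hD w (a true)
  have ho1 : (pairWeight κ D e a hD).out (pairState e a hD true w₀) true =
    true :: List.replicate (e + (a false - κ) / D) false := rfl
  have ho2 : ∀ w, (pairWeight κ D e a hD).out (pairState e a hD false w) true =
    List.replicate ((counterRem κ D w + a true - κ) / D) false := fun _ => rfl
  obtain ⟨h1, h2⟩ := pairWeight_zeros (κ := κ) e a hD false (a false) x
  set w := a false + x * a false with hw
  obtain ⟨h3, h4⟩ := pairWeight_zeros (κ := κ) e a hD true (w + a true) y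
  refine ⟨⟨w + a true + y * a true, ?_⟩, ?_⟩
  · rw [FST.run_append, FST.run_cons _ _ _ (List.replicate x false), hs1, h1, FST.run_cons, hs2, h3]
  · rw [FST.output_append, FST.run_cons,
      FST.output_cons _ _ _ (List.replicate x false), hs1, h1, h2, ho1, FST.output_cons, hs2, h4, ho2]
    have e1 : (w + a true + y * a true - κ) / D = z := by
      rw [show w + a true + y * a true = κ + D * z by rw [← h]; simp only [hw]; ring,
        Nat.add_sub_cancel_left, Nat.mul_div_cancel_left _ hD]
    have e2 := counterRem_add_div (κ := κ) hD w (a true)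
    have e3 : (w + a true - κ) / D ≤ (w + a true + y * a true - κ) / D :=
      Nat.div_le_div_right (by omega)
    have e4 : (a false - κ) / D ≤ (w - κ) / D := Nat.div_le_div_right (by omega)
    rw [List.cons_append, List.replicate_append_replicate, List.replicate_append_replicate,
      List.cons_append, List.replicate_append_replicate]
    rw [e1, e2] at *
    generalize (w - κ) / D = i at *
    generalize (counterRem κ D w + a true - κ) / D = j at *
    generalize (a false - κ) / D = j' at *
    congr 2
    omega

theorem blockSeq_transducible_pairWeight (hD : 0 < D) {f z : ℕ → ℕ}
    (h : ∀ t, (f (2 * t) + 1) * a false + (f (2 * t + 1) + 1) * a true = κ + D * z t) :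
    Transducible (blockSeq f) (blockSeq fun t => e + z t) := by
  have key : ∀ t, (∃ c, (pairWeight κ D e a hD).run (pairWeight κ D e a hD).init
      (blockPrefix f (2 * t)) = pairState e a hD true c) ∧
      (pairWeight κ D e a hD).output (pairWeight κ D e a hD).init (blockPrefix f (2 * t)) =
        blockPrefix (fun t => e + z t) t := by
    intro t
    induction t with
    | zero => exact ⟨⟨_, rfl⟩, rfl⟩
    | succ t ih =>
      obtain ⟨⟨c, hc⟩, ho⟩ := ih
      obtain ⟨⟨c', h1⟩, h2⟩ := pairWeight_blocks (κ := κ) e a hD c _ _ _ (h t)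
      rw [show 2 * (t + 1) = 2 * t + 1 + 1 by ring, blockPrefix_succ, blockPrefix_succ,
        List.append_assoc, FST.run_append, FST.output_append, hc, ho, h1, h2]
      exact ⟨⟨c', rfl⟩, (blockPrefix_succ _ _).symm⟩
  refine ⟨pairWeight κ D e a hD, fun n => ?_, fun m => ⟨blockPos f (2 * m), ?_⟩⟩
  -- An arbitrary prefix of length `n` is compared with the first `2 * n` blocks, which contain it.
  · refine eq_seqPrefix_of_getElem? fun k hk => ?_
    obtain ⟨j, hj⟩ := Nat.exists_eq_add_of_le
      ((show n ≤ 2 * n by omega).trans (le_blockPos f (2 * n)))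
    obtain ⟨u, hu⟩ := seqPrefix_add (blockSeq f) n j
    rw [← hj, ← blockPrefix_eq_seqPrefix] at hu
    have h1 := (key n).2
    rw [hu, FST.output_append] at h1
    have h2 : k < blockPos (fun t => e + z t) n := by
      rw [← length_blockPrefix, ← h1, List.length_append]; omega
    rw [← getElem?_blockPrefix _ h2, ← h1, List.getElem?_append_left hk]
  · rw [← blockPrefix_eq_seqPrefix, (key m).2, length_blockPrefix]
    exact le_blockPos _ _

end pairWeight

/-- Blocks whose lengths grow as a quadratic polynomial can be turned into squares. -/
theorem blockSeq_quadratic_transducible_squares {f : ℕ → ℕ} {A B C : ℕ} (hA : 0 < A)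
    (hf : ∀ i, f i + 1 = A * i ^ 2 + B * i + C) :
    Transducible (blockSeq f) (blockSeq fun n => n ^ 2) := by
  -- Weights `r` and `s` with `r + s = 2 * A` give the pair sum leading term `8 * A ^ 2 * t ^ 2`,
  -- and `s` raises the residue `r` of `B` to `2 * A`. After a shift by `b + 1` the linear term is
  -- `8 * A ^ 2 * (2 * (b + 1)) * t`, and adding `(b + 1) ^ 2` completes the square to `(b + 1 + t)
  -- ^ 2`.
  obtain ⟨b, r, hr, hB⟩ : ∃ b r, r < 2 * A ∧ B = 2 * A * b + r :=
    ⟨B / (2 * A), B % (2 * A), Nat.mod_lt _ (by omega), (Nat.div_add_mod _ _).symm⟩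
  obtain ⟨s, hs⟩ := Nat.exists_eq_add_of_le hr.le
  refine (blockSeq_transducible_shift f (b + 1)).trans
    (Transducible.trans ?_ (blockSeq_shift_transducible _ (b + 1)))
  have := blockSeq_transducible_pairWeight (f := fun i => f (b + 1 + i))
    (κ := r * (f (b + 1) + 1) + s * (f (b + 2) + 1)) (D := 8 * A ^ 2) ((b + 1) ^ 2)
    (fun x => bif x then s else r) (by positivity) (z := fun t => t ^ 2 + 2 * (b + 1) * t) ?_
  · convert this using 3
    ring
  · intro t
    simp only [hf, cond_true, cond_false]
    subst hB
    obtain rfl : r = 2 * A - s := by omega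
    zify [show s ≤ 2 * A by omega]
    ring

/-! ### Mismatches with a fixed shift -/

/-- The positions at which `τ` differs from its shift by `L`. -/
def mismatch (τ : ℕ → Bool) (L m : ℕ) : Bool := xor (τ m) (τ (m + L))

theorem mismatch_eq_false_iff {τ : ℕ → Bool} {L m : ℕ} :
    mismatch τ L m = false ↔ τ (m + L) = τ m := by
  unfold mismatch
  generalize τ m = x, τ (m + L) = y
  cases x <;> cases y <;> decide

/-- A transducer cannot look ahead, so it remembers the last `L` letters and answers with delay `L`;
the first `L` answers are dropped. -/
theorem transducible_mismatch (τ : ℕ → Bool) (L : ℕ) : Transducible τ (mismatch τ L) := by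
  let ρ : ℕ → Bool := fun m => xor (if m < L then false else τ (m - L)) (τ m)
  have hρ : (fun m => ρ (L + m)) = mismatch τ L := by
    funext m
    simp [ρ, mismatch, Nat.add_comm]
  rw [← hρ]
  refine Transducible.trans ?_ (transducible_drop ρ L)
  -- The extra slot, constantly `false`, keeps the index `0` meaningful when `L = 0`.
  refine transducible_of_letterwise (S := Fin (L + 1) → Bool)
    (fun m i => if m + i < L then false else if i.1 < L then τ (m + i - L) else false)
    (Set.toFinite _)
    (fun s x i => if h : i.1 + 1 < L then s ⟨i + 1, by omega⟩ else
      if i.1 < L then x else false)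
    (fun s x => xor (if L = 0 then x else s 0) x) (fun m => ?_) (fun m => ?_)
  · funext i
    dsimp only
    by_cases h : i.1 + 1 < L
    · rw [dif_pos h, if_pos (show i.1 < L by omega), if_pos h,
        show m + 1 + i.1 = m + (i.1 + 1) by omega]
    · rw [dif_neg h]
      by_cases h' : i.1 < L
      · rw [if_pos h', if_pos h', if_neg (by omega), show m + 1 + i.1 - L = m by omega]
      · rw [if_neg h', if_neg h', ite_self]
  · rcases Nat.eq_zero_or_pos L with rfl | h
    · simp [ρ]
    · simp [ρ, h, h.ne']

theorem exists_mismatch {τ : ℕ → Bool} (h : ¬ UltimatelyPeriodic τ) {L : ℕ} (hL : 0 < L) (M : ℕ) :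
    ∃ m ≥ M, mismatch τ L m = true := by
  by_contra! hc
  exact h ⟨M, L, hL, fun n hn => mismatch_eq_false_iff.1 (by simpa using hc n hn)⟩

/-! ### Selecting every `K`-th one -/

theorem count_congr_of_lt {P Q : ℕ → Prop} [DecidablePred P] [DecidablePred Q] {n : ℕ}
    (h : ∀ k < n, P k ↔ Q k) : Nat.count P n = Nat.count Q n := by
  induction n with
  | zero => simp
  | succ n ih =>
    rw [Nat.count_succ, Nat.count_succ, ih fun k hk => h k (by omega)]
    simp [h n (by omega)]

theorem transducible_select (σ : ℕ → Bool) {K : ℕ} (hK : 0 < K) :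
    Transducible σ fun m => σ m && decide (K ∣ Nat.count (fun k => σ k = true) m) := by
  refine transducible_of_letterwise (fun m => Nat.count (fun k => σ k = true) m % K)
    ((Set.finite_Iio K).subset (by rintro _ ⟨m, rfl⟩; exact Nat.mod_lt _ hK))
    (fun s x => if x then (s + 1) % K else s) (fun s x => x && decide (s = 0))
    (fun m => ?_) (fun m => ?_)
  · rw [Nat.count_succ]
    split_ifs <;> simp
  · simp [Nat.dvd_iff_mod_eq_zero]

/-- From `p 0` on, the ones whose rank is a multiple of `K` are exactly those at the positions `p
i`: a one strictly between `p i` and `p (i + 1)` has rank strictly between `K * i` and `K * (i +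
1)`. -/
theorem transducible_blockSeq_of_count {σ : ℕ → Bool} {p f : ℕ → ℕ} {K : ℕ}
    (hK : 0 < K) (hσ : ∀ i, σ (p i) = true) (hp : ∀ i, p (i + 1) = p i + (f i + 1))
    (hcount : ∀ i, Nat.count (fun k => σ k = true) (p i) =
      Nat.count (fun k => σ k = true) (p 0) + K * i) :
    Transducible σ (blockSeq f) := by
  refine (transducible_drop σ (p 0)).trans ?_
  have h := transducible_select (fun m => σ (p 0 + m)) hK
  convert h using 1
  refine (eq_blockSeq fun i k hk => ?_).symm
  have hpos : ∀ i, p 0 + blockPos f i = p i := by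
    intro i
    induction i with
    | zero => rfl
    | succ i ih => rw [blockPos_succ, hp, ← ih, Nat.add_assoc]
  have hc := Nat.count_add (fun k => σ k = true) (p 0) (blockPos f i + k)
  rw [← Nat.add_assoc, hpos] at hc ⊢
  rcases k with _ | k
  · rw [Nat.add_zero, hcount, Nat.add_zero] at hc
    simp only [Nat.add_zero, hσ, Bool.true_and, decide_true, decide_eq_true_eq]
    rw [← Nat.add_left_cancel hc]
    exact dvd_mul_right _ _
  · simp only [Nat.add_eq_zero_iff, one_ne_zero, and_false, decide_false,
      Bool.and_eq_false_iff, decide_eq_false_iff_not]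
    rw [or_iff_not_imp_left, Bool.not_eq_false]
    rintro hs ⟨t, ht⟩
    rw [ht] at hc
    have h1 := Nat.count_strict_mono (p := fun k => σ k = true) (hσ i)
      (show p i < p i + (k + 1) by omega)
    have h2 := Nat.count_strict_mono (p := fun k => σ k = true) hs
      (show p i + (k + 1) < p (i + 1) by rw [hp]; omega)
    rw [hc, hcount i] at h1
    rw [hc, hcount (i + 1)] at h2
    have h3 : i < t := Nat.lt_of_mul_lt_mul_left (a := K) (by omega)
    have h4 : t < i + 1 := Nat.lt_of_mul_lt_mul_left (a := K) (by omega)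
    omega

/-! ### Sequences composed of pieces of quadratically growing length -/

section Pieces

variable {τ : ℕ → Bool} {a h γ : ℕ → ℕ} {N L X n₀ ν : ℕ}

theorem sum_range_pieces (hA : ∀ n ≥ n₀, a (n + 1) = a n + h n) {n : ℕ} (hn : n₀ ≤ n) (t : ℕ) :
    a (n + t) = a n + ∑ j ∈ Finset.range t, h (n + j) := by
  induction t with
  | zero => simp
  | succ t ih => rw [← Nat.add_assoc, hA _ (by omega), ih, Finset.sum_range_succ, Nat.add_assoc]

/-- Piece `n` occupies `h n` positions from `a n` on. A position past its end but at distance less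
than `n` from `a n` lies behind a short piece, hence one with `h (n + N) = h n`; the comparison then
passes to the next piece. -/
theorem piece_stable (hub : ∀ m, ∃ n, m ≤ a n) (hA : ∀ n ≥ n₀, a (n + 1) = a n + h n)
    (hB : ∀ n ≥ n₀, ∀ k < h n, τ (a n + k) = τ (a (n + N) + k))
    (hD : ∀ n ≥ n₀, h (n + N) = h n ∨ n ≤ h n) {n k : ℕ} (hn : n₀ ≤ n) (hk : k < n) :
    τ (a n + k) = τ (a (n + N) + k) := by
  have key : ∀ t n k, n₀ ≤ n → k < n → a n + k < a (n + t) →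
      τ (a n + k) = τ (a (n + N) + k) := by
    intro t
    induction t with
    | zero => intro n k _ _ h; simp at h
    | succ t ih =>
      intro n k hn hk hlt
      by_cases hkh : k < h n
      · exact hB n hn k hkh
      · obtain ⟨j, rfl⟩ := Nat.exists_eq_add_of_le (not_lt.1 hkh)
        have h1 := (hD n hn).resolve_right (by omega)
        have h2 := hA n hn
        have h3 := hA (n + N) (by omega)
        have h4 := ih (n + 1) j (by omega) (by omega)
          (by rw [show n + 1 + t = n + (t + 1) by omega]; omega)
        rw [show n + 1 + N = n + N + 1 by omega, h2, h3, h1] at h4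
        rwa [← Nat.add_assoc, ← Nat.add_assoc]
  obtain ⟨m, hm⟩ := hub (a n + k + 1 + ∑ i ∈ Finset.range n, a i)
  have hnm : n ≤ m := by
    by_contra hlt
    have := Finset.single_le_sum (f := a) (fun _ _ => Nat.zero_le _)
      (Finset.mem_range.2 (show m < n by omega))
    omega
  obtain ⟨t, rfl⟩ := Nat.exists_eq_add_of_le hnm
  exact key t n k hn hk (by omega)

theorem ultimatelyPeriodic_of_pieces (hub : ∀ m, ∃ n, m ≤ a n)
    (hA : ∀ n ≥ n₀, a (n + 1) = a n + h n)
    (hB : ∀ n ≥ n₀, ∀ k < h n, τ (a n + k) = τ (a (n + N) + k))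
    (hh : ∀ n ≥ n₀, h (n + N) = h n) (hpos : 0 < h n₀) (hN : 0 < N) : UltimatelyPeriodic τ := by
  have hP : ∀ i, a (n₀ + i + N) = a (n₀ + i) + ∑ j ∈ Finset.range N, h (n₀ + j) := by
    intro i
    induction i with
    | zero => exact sum_range_pieces hA le_rfl N
    | succ i ih =>
      rw [show n₀ + (i + 1) + N = n₀ + i + N + 1 by omega, hA _ (by omega), ih, hh _ (by omega),
        ← Nat.add_assoc, hA _ (by omega)]
      omega
  refine ⟨a n₀, ∑ j ∈ Finset.range N, h (n₀ + j), ?_, fun m hm => ?_⟩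
  · exact Finset.sum_pos' (fun _ _ => Nat.zero_le _) ⟨0, Finset.mem_range.2 hN, hpos⟩
  · obtain ⟨n, hn, h1, h2⟩ := exists_interval_of_unbounded hub
      (fun n hn => by rw [hA n hn]; omega) hm
    rw [hA n hn] at h2
    have h3 := hB n hn (m - a n) (by omega)
    obtain ⟨i, rfl⟩ := Nat.exists_eq_add_of_le hn
    rw [hP] at h3
    rw [show a (n₀ + i) + (m - a (n₀ + i)) = m by omega] at h3
    rw [h3]
    congr 1
    omega

/-- The increments are proportional to `(n + 1 + N) ^ 2 - (n + 1) ^ 2` and telescope. -/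
theorem piece_length (hC : ∀ n ≥ n₀, h (n + N) = h n + γ n * (ν * (2 * (n + 1) + N)))
    (hγ : ∀ n ≥ n₀, γ (n + N) = γ n) {n : ℕ} (hn : n₀ ≤ n) (i : ℕ) :
    h (n + N * i) = h n + γ n * (ν * (N * i ^ 2 + 2 * (n + 1) * i)) := by
  have hγ' : ∀ i, γ (n + N * i) = γ n := by
    intro i
    induction i with
    | zero => rfl
    | succ i ih => rw [Nat.mul_succ, ← Nat.add_assoc, hγ _ (by omega), ih]
  induction i with
  | zero => simp
  | succ i ih =>
    rw [Nat.mul_succ, ← Nat.add_assoc, hC _ (by omega), ih, hγ']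
    ring

/-- All mismatches lie among the first `X` positions of a piece, where the patterns in pieces `n`
and `n + N` agree. -/
theorem count_piece (hC : ∀ n ≥ n₀, h (n + N) = h n ∨ n ≤ h n ∧ n ≤ h (n + N))
    (hstab : ∀ n k, n₀ ≤ n → k + L < n →
      mismatch τ L (a n + k) = mismatch τ L (a (n + N) + k))
    (hE : ∀ n ≥ n₀, ∀ k, X ≤ k → k < h n → τ (a n + k + L) = τ (a n + k))
    {n : ℕ} (hn : n₀ ≤ n) (hX : X + L < n) :
    Nat.count (fun k => mismatch τ L (a n + k) = true) (h n) =
      Nat.count (fun k => mismatch τ L (a (n + N) + k) = true) (h (n + N)) := by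
  have key : ∀ n ≥ n₀, Nat.count (fun k => mismatch τ L (a n + k) = true) (h n) =
      Nat.count (fun k => mismatch τ L (a n + k) = true) (min X (h n)) := by
    intro n hn
    obtain ⟨j, hj⟩ := Nat.exists_eq_add_of_le (min_le_right X (h n))
    conv_lhs => rw [hj, Nat.count_add]
    rw [Nat.add_eq_left, Nat.count_iff_forall_not]
    intro k hk hm
    rw [mismatch_eq_false_iff.2 (hE n hn _ (by omega) (by omega))] at hm
    exact Bool.false_ne_true hm
  rw [key n hn, key (n + N) (by omega),
    show min X (h (n + N)) = min X (h n) by rcases hC n hn with h | h <;> omega]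
  refine count_congr_of_lt fun k hk => ?_
  rw [hstab n k hn (by omega)]

theorem ultimatelyPeriodic_or_transducible_squares (hN : 0 < N) (hL : 0 < L) (hν : 0 < ν)
    (hub : ∀ m, ∃ n, m ≤ a n) (hA : ∀ n ≥ n₀, a (n + 1) = a n + h n)
    (hB : ∀ n ≥ n₀, ∀ k < h n, τ (a n + k) = τ (a (n + N) + k))
    (hC : ∀ n ≥ n₀, h (n + N) = h n + γ n * (ν * (2 * (n + 1) + N)))
    (hγ : ∀ n ≥ n₀, γ (n + N) = γ n) (hD : ∀ n ≥ n₀, 0 < γ n → n ≤ h n)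
    (hE : ∀ n ≥ n₀, ∀ k, X ≤ k → k < h n → τ (a n + k + L) = τ (a n + k)) :
    UltimatelyPeriodic τ ∨ Transducible τ (blockSeq fun n => n ^ 2) := by
  rw [or_iff_not_imp_left]
  intro hper
  have hCD : ∀ n ≥ n₀, h (n + N) = h n ∨ n ≤ h n ∧ n ≤ h (n + N) := by
    intro n hn
    rcases Nat.eq_zero_or_pos (γ n) with h0 | h0
    · left; rw [hC n hn, h0]; simp
    · right
      have := hD n hn h0
      have := hC n hn
      omega
  have hstab : ∀ n k, n₀ ≤ n → k + L < n →
      mismatch τ L (a n + k) = mismatch τ L (a (n + N) + k) := by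
    intro n k hn hk
    have hD' : ∀ n ≥ n₀, h (n + N) = h n ∨ n ≤ h n := fun n hn => (hCD n hn).imp_right And.left
    rw [mismatch, mismatch, Nat.add_assoc, Nat.add_assoc,
      piece_stable hub hA hB hD' hn (show k < n by omega),
      piece_stable hub hA hB hD' hn (show k + L < n by omega)]
  -- The mismatch is taken so late that its offset `u < X` in piece `n₁` satisfies `u + L < n₁`; it
  -- then recurs in every piece `n₁ + N * i`.
  obtain ⟨m, hm, hmis⟩ := exists_mismatch hper hL (a (n₀ + X + L + 1))
  obtain ⟨n₁, hn₁, h1, h2⟩ := exists_interval_of_unbounded hub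
    (fun n hn => by rw [hA n (by omega)]; omega) hm
  obtain ⟨u, rfl⟩ := Nat.exists_eq_add_of_le h1
  rw [hA _ (by omega)] at h2
  have hu : u < X := by
    by_contra hc
    rw [mismatch_eq_false_iff.2 (hE n₁ (by omega) u (by omega) (by omega))] at hmis
    exact Bool.false_ne_true hmis
  have hstab' : ∀ k ≤ u, ∀ i, mismatch τ L (a (n₁ + N * i) + k) = mismatch τ L (a n₁ + k) := by
    intro k hk i
    induction i with
    | zero => rfl
    | succ i ih => rw [Nat.mul_succ, ← Nat.add_assoc, ← hstab _ _ (by omega) (by omega), ih]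
  have hcp : ∀ j i, Nat.count (fun k => mismatch τ L (a (n₁ + N * i + j) + k) = true)
      (h (n₁ + N * i + j)) =
      Nat.count (fun k => mismatch τ L (a (n₁ + j) + k) = true) (h (n₁ + j)) := by
    intro j i
    induction i with
    | zero => rfl
    | succ i ih =>
      rw [show n₁ + N * (i + 1) + j = n₁ + N * i + j + N by ring,
        ← count_piece hCD hstab hE (by omega) (by omega), ih]
  have hround := fun i => sum_range_pieces hA (show n₀ ≤ n₁ + N * i by omega) N
  have hlen : ∀ i j, h (n₁ + N * i + j) =
      h (n₁ + j) + γ (n₁ + j) * (ν * (N * i ^ 2 + 2 * (n₁ + j + 1) * i)) := by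
    intro i j
    rw [← piece_length hC hγ (by omega), show n₁ + N * i + j = n₁ + j + N * i by omega]
  set G : ℕ := ∑ j ∈ Finset.range N, γ (n₁ + j) with hG
  have hGpos : 0 < G := by
    rw [Nat.pos_iff_ne_zero]
    intro h0
    rw [hG, Finset.sum_eq_zero_iff] at h0
    refine hper (ultimatelyPeriodic_of_pieces (n₀ := n₁) hub (fun n hn => hA n (by omega))
      (fun n hn => hB n (by omega)) (fun n hn => ?_) (by omega) hN)
    have hz : γ n = 0 := by
      obtain ⟨t, rfl⟩ := Nat.exists_eq_add_of_le hn
      have hγ' : ∀ i, γ (n₁ + t % N + N * i) = γ (n₁ + t % N) := by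
        intro i
        induction i with
        | zero => rfl
        | succ i ih => rw [Nat.mul_succ, ← Nat.add_assoc, hγ _ (by omega), ih]
      have := hγ' (t / N)
      rw [Nat.add_assoc, Nat.mod_add_div] at this
      rw [this]
      exact h0 _ (Finset.mem_range.2 (Nat.mod_lt _ hN))
    rw [hC n (by omega), hz]
    simp
  let g : ℕ → ℕ := fun i => ∑ j ∈ Finset.range N, h (n₁ + N * i + j)
  have hg : ∀ i, g i = ν * N * G * i ^ 2 +
      (∑ j ∈ Finset.range N, γ (n₁ + j) * ν * 2 * (n₁ + j + 1)) * i +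
      ∑ j ∈ Finset.range N, h (n₁ + j) := by
    intro i
    simp only [g, hlen, hG, Finset.mul_sum, Finset.sum_mul]
    rw [← Finset.sum_add_distrib, ← Finset.sum_add_distrib]
    refine Finset.sum_congr rfl fun j _ => ?_
    ring
  have hgpos : ∀ i, 0 < g i := by
    intro i
    have : h n₁ ≤ ∑ j ∈ Finset.range N, h (n₁ + j) :=
      Finset.single_le_sum (f := fun j => h (n₁ + j)) (fun _ _ => Nat.zero_le _)
        (Finset.mem_range.2 hN)
    rw [hg]
    omega
  let p : ℕ → ℕ := fun i => a (n₁ + N * i) + u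
  have hp : ∀ i, p (i + 1) = p i + (g i - 1 + 1) := by
    intro i
    rw [Nat.sub_add_cancel (hgpos i)]
    simp only [p, g]
    rw [Nat.mul_succ, ← Nat.add_assoc, hround]
    omega
  have hpm : ∀ i, mismatch τ L (p i) = true := fun i => (hstab' u le_rfl i).trans hmis
  set K : ℕ := ∑ j ∈ Finset.range N,
    Nat.count (fun k => mismatch τ L (a (n₁ + j) + k) = true) (h (n₁ + j)) with hK
  have hcount_round : ∀ i, Nat.count (fun k => mismatch τ L k = true) (a (n₁ + N * (i + 1))) =
      Nat.count (fun k => mismatch τ L k = true) (a (n₁ + N * i)) + K := by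
    intro i
    -- The summation lemma is applied to numbers of mismatches in place of positions.
    have := sum_range_pieces (n₀ := n₁ + N * i)
      (a := fun n => Nat.count (fun k => mismatch τ L k = true) (a n))
      (h := fun n => Nat.count (fun k => mismatch τ L (a n + k) = true) (h n))
      (fun n hn => by rw [hA n (by omega), Nat.count_add]) le_rfl N
    simp only [hcp] at this
    rw [Nat.mul_succ, ← Nat.add_assoc, this]
  have hcount : ∀ i, Nat.count (fun k => mismatch τ L k = true) (p i) =
      Nat.count (fun k => mismatch τ L k = true) (p 0) + K * i := by
    intro i
    induction i with
    | zero => rfl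
    | succ i ih =>
      have h0 : ∀ i, Nat.count (fun k => mismatch τ L k = true) (p i) =
          Nat.count (fun k => mismatch τ L k = true) (a (n₁ + N * i)) +
          Nat.count (fun k => mismatch τ L (a n₁ + k) = true) u := by
        intro i
        simp only [p]
        rw [Nat.count_add]
        congr 1
        exact count_congr_of_lt fun k hk => by rw [hstab' k hk.le]
      rw [h0, hcount_round, Nat.mul_succ, ← Nat.add_assoc, ← ih, h0]
      omega
  have hKpos : 0 < K := by
    have h3 := Nat.count_strict_mono (p := fun k => mismatch τ L k = true) (hpm 0)
      (show p 0 < p 1 by rw [hp]; omega)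
    rw [hcount 1] at h3
    omega
  refine (transducible_mismatch τ L).trans
    ((transducible_blockSeq_of_count (f := fun i => g i - 1) hKpos hpm hp hcount).trans ?_)
  exact blockSeq_quadratic_transducible_squares (by positivity)
    fun i => (Nat.sub_add_cancel (hgpos i)).trans (hg i)

end Pieces

/-! ### Reading long runs of zeros -/

/-- The word `0^m`. -/
abbrev zeros (m : ℕ) : List Bool := List.replicate m false

theorem zeros_add (m n : ℕ) : zeros (m + n) = zeros m ++ zeros n :=
  List.replicate_add _ _ _

namespace FST

variable (T : FST)

theorem run_zeros_add (q : T.Q) (m n : ℕ) :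
    T.run q (zeros (m + n)) = T.run (T.run q (zeros m)) (zeros n) := by
  rw [zeros_add, run_append]

theorem output_zeros_add (q : T.Q) (m n : ℕ) :
    T.output q (zeros (m + n)) =
      T.output q (zeros m) ++ T.output (T.run q (zeros m)) (zeros n) := by
  rw [zeros_add, output_append]

/-- Some power of the transformation of the states by the letter `0` is idempotent. -/
theorem exists_run_zeros_idempotent :
    ∃ Z > 0, ∀ q, T.run (T.run q (zeros Z)) (zeros Z) = T.run q (zeros Z) := by
  have := T.finite_Q
  obtain ⟨i, j, hne, hij⟩ := Finite.exists_ne_map_eq_of_infinite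
    fun m q => T.run q (zeros m)
  wlog hlt : i < j generalizing i j
  · exact this j i hne.symm hij.symm (by omega)
  obtain ⟨P, rfl⟩ := Nat.exists_eq_add_of_lt hlt
  have h1 : ∀ k q, T.run q (zeros (i + k + (P + 1))) = T.run q (zeros (i + k)) := by
    intro k q
    have := congrFun hij q
    rw [show i + k + (P + 1) = i + P + 1 + k by omega, run_zeros_add, ← this, ← run_zeros_add]
  have h2 : ∀ t k q, T.run q (zeros (i + k + (P + 1) * t)) = T.run q (zeros (i + k)) := by
    intro t
    induction t with
    | zero => intro k q; rfl
    | succ t ih =>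
      intro k q
      rw [Nat.mul_succ, ← Nat.add_assoc, Nat.add_assoc i, h1, ← Nat.add_assoc, ih]
  refine ⟨(P + 1) * (i + 1), by positivity, fun q => ?_⟩
  rw [← run_zeros_add]
  have h3 := h2 (i + 1) ((P + 1) * (i + 1) - i) q
  -- A multiple of the period `P + 1` that is at least the preperiod `i` is an idempotent exponent.
  have h4 : i ≤ (P + 1) * (i + 1) := by nlinarith
  rwa [show i + ((P + 1) * (i + 1) - i) = (P + 1) * (i + 1) by omega] at h3

section Cycle

variable {T} {Z : ℕ} {q : T.Q} (hq : T.run q (zeros Z) = q)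
include hq

theorem run_zeros_cycle (r : ℕ) : T.run q (zeros (Z * r)) = q := by
  induction r with
  | zero => rfl
  | succ r ih => rw [Nat.mul_succ, run_zeros_add, ih, hq]

theorem run_zeros_cycle_add (r m : ℕ) : T.run q (zeros (Z * r + m)) = T.run q (zeros m) := by
  rw [run_zeros_add, run_zeros_cycle hq]

theorem output_zeros_cycle_add (r m : ℕ) : T.output q (zeros (Z * r + m)) =
    T.output q (zeros (Z * r)) ++ T.output q (zeros m) := by
  rw [output_zeros_add, run_zeros_cycle hq]

theorem length_output_zeros_cycle (r : ℕ) :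
    (T.output q (zeros (Z * r))).length = r * (T.output q (zeros Z)).length := by
  induction r with
  | zero => simp [output]
  | succ r ih =>
    rw [Nat.mul_succ, output_zeros_add, run_zeros_cycle hq, List.length_append, ih]
    ring

theorem length_output_zeros_cycle_add (r m : ℕ) : (T.output q (zeros (Z * r + m))).length =
    r * (T.output q (zeros Z)).length + (T.output q (zeros m)).length := by
  rw [output_zeros_cycle_add hq, List.length_append, length_output_zeros_cycle hq]

/-- Reading `Z * r` more zeros first returns to `q` and puts `L` letters in front of the same
output. -/
theorem getElem?_output_zeros_cycle {L m x : ℕ} (hL : (T.output q (zeros Z)).length ∣ L)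
    (hx : x + L < (T.output q (zeros m)).length) :
    (T.output q (zeros m))[x + L]? = (T.output q (zeros m))[x]? := by
  obtain ⟨r, rfl⟩ := hL
  have h1 := length_output_zeros_cycle hq r
  rw [Nat.mul_comm r] at h1
  have h2 : (T.output q (zeros (Z * r + m)))[x + (T.output q (zeros Z)).length * r]? =
      (T.output q (zeros m))[x]? := by
    rw [output_zeros_cycle_add hq, List.getElem?_append_right (by omega), h1,
      Nat.add_sub_cancel]
  rw [← h2, Nat.add_comm (Z * r), output_zeros_add, List.getElem?_append_left hx]

end Cycle

theorem length_output_zeros_mono (q : T.Q) {m n : ℕ} (h : m ≤ n) :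
    (T.output q (zeros m)).length ≤ (T.output q (zeros n)).length := by
  obtain ⟨k, rfl⟩ := Nat.exists_eq_add_of_le h
  rw [output_zeros_add, List.length_append]
  omega

/-- The first `n` blocks of `blockSeq f`, followed by the next block without its last `S`
zeros. -/
def cut (f : ℕ → ℕ) (S n : ℕ) : List Bool := blockPrefix f n ++ true :: zeros (f n - S)

theorem cut_append (f : ℕ → ℕ) {S n : ℕ} (h : S ≤ f n) :
    cut f S n ++ zeros S = blockPrefix f (n + 1) := by
  rw [cut, blockPrefix_succ, List.append_assoc, List.cons_append, ← zeros_add,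
    Nat.sub_add_cancel h]

theorem cut_succ (f : ℕ → ℕ) {S n : ℕ} (h : S ≤ f n) :
    cut f S (n + 1) = cut f S n ++ (zeros S ++ true :: zeros (f (n + 1) - S)) := by
  rw [← List.append_assoc, cut_append f h, cut]

theorem Transduces.getElem?_output {T : FST} {σ τ : ℕ → Bool} (hT : T.Transduces σ τ)
    {u v : List Bool} {n : ℕ} (h : u ++ v = seqPrefix σ n) {k : ℕ}
    (hk : k < (T.output (T.run T.init u) v).length) :
    (T.output (T.run T.init u) v)[k]? = some (τ ((T.output T.init u).length + k)) := by
  have h1 := hT.1 n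
  rw [← h, output_append] at h1
  rw [← getElem?_seqPrefix τ
    (show _ < (T.output T.init u ++ T.output (T.run T.init u) v).length by
      rw [List.length_append]; omega), ← h1, List.getElem?_append_right (by omega),
    Nat.add_sub_cancel_left]

theorem Transduces.unbounded_cut {T : FST} {f : ℕ → ℕ} {τ : ℕ → Bool}
    (hT : T.Transduces (blockSeq f) τ) (S m : ℕ) :
    ∃ n, m ≤ (T.output T.init (cut f S n)).length := by
  obtain ⟨n, hn⟩ := hT.2 m
  refine ⟨n, hn.trans ?_⟩
  obtain ⟨j, hj⟩ := Nat.exists_eq_add_of_le (le_blockPos f n)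
  obtain ⟨u, hu⟩ := seqPrefix_add (blockSeq f) n j
  rw [cut, blockPrefix_eq_seqPrefix, hj, hu, List.append_assoc, output_append, List.length_append]
  omega

/-- A transduct of `⟨n²⟩` is ultimately periodic, or it can be transduced back. -/
theorem Transduces.squares {T : FST} {τ : ℕ → Bool}
    (hT : T.Transduces (blockSeq fun n => n ^ 2) τ) :
    UltimatelyPeriodic τ ∨ Transducible τ (blockSeq fun n => n ^ 2) := by
  classical
  have := T.finite_Q
  have := Fintype.ofFinite T.Q
  obtain ⟨Z, hZ, hidem⟩ := T.exists_run_zeros_idempotent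
  let c : T.Q → ℕ := fun q => (T.output q (zeros Z)).length
  -- A common multiple of all nonzero cycle outputs; `max 1` skips the silent cycles.
  let L : ℕ := ∏ q, max 1 (c q)
  have hL : 0 < L := Finset.prod_pos fun q _ => by omega
  have hcL : ∀ q, 0 < c q → c q ∣ L := by
    intro q hq
    have := Finset.dvd_prod_of_mem (fun q => max 1 (c q)) (Finset.mem_univ q)
    rwa [show max 1 (c q) = c q by omega] at this
  -- On a cycle that is not silent, the `S` zeros held back yield at least `L` more letters, so
  -- comparing with the shift by `L` never leaves the periodic output.
  let S : ℕ := Z * L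
  let head : List Bool := zeros S ++ true :: zeros Z
  let X : ℕ := ∑ q, (T.output q head).length
  have hX : ∀ q, (T.output q head).length ≤ X := fun q =>
    Finset.single_le_sum (f := fun q => (T.output q head).length) (fun _ _ => Nat.zero_le _)
      (Finset.mem_univ q)
  let s : ℕ → T.Q := fun n => T.run T.init (cut (fun n => n ^ 2) S n)
  let a : ℕ → ℕ := fun n => (T.output T.init (cut (fun n => n ^ 2) S n)).length
  let M : ℕ → ℕ := fun n => (n + 1) ^ 2 - S - Z
  let q : ℕ → T.Q := fun n => T.run (s n) head
  have hq : ∀ n, T.run (q n) (zeros Z) = q n := by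
    intro n
    simp only [q, head]
    rw [run_append, run_cons, hidem]
  let W : ℕ → List Bool := fun n => T.output (s n) head ++ T.output (q n) (zeros (M n))
  let m₀ : ℕ := S + Z
  have hM : ∀ n ≥ m₀, Z * n + Z + S ≤ (n + 1) ^ 2 ∧ S ≤ n ^ 2 := by
    intro n hn
    simp only [m₀] at hn
    constructor <;> nlinarith
  have hM' : ∀ n ≥ m₀, (n + 1) ^ 2 = M n + S + Z := by
    intro n hn
    have := hM n hn
    simp only [M]
    omega
  have hMb : ∀ b, ∀ n ≥ m₀,
      M (n + Z * b) = Z * (b * (2 * (n + 1) + Z * b)) + M n := by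
    intro b n hn
    have h2 := hM' n (by omega)
    have h3 := hM' (n + Z * b) (by omega)
    have h4 : (n + Z * b + 1) ^ 2 = Z * (b * (2 * (n + 1) + Z * b)) + (n + 1) ^ 2 := by
      ring
    omega
  have hcut : ∀ n ≥ m₀, cut (fun n => n ^ 2) S (n + 1) =
      cut (fun n => n ^ 2) S n ++ (head ++ zeros (M n)) := by
    intro n hn
    rw [cut_succ (fun n => n ^ 2) (hM n hn).2]
    simp only [head]
    rw [List.append_assoc, List.cons_append, ← zeros_add,
      show (n + 1) ^ 2 - S = Z + M n by rw [hM' n hn]; omega]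
  have hs : ∀ n ≥ m₀, s (n + 1) = T.run (q n) (zeros (M n)) := by
    intro n hn
    simp only [s, q]
    rw [hcut n hn, run_append, run_append]
  have ha : ∀ n ≥ m₀, a (n + 1) = a n + (W n).length := by
    intro n hn
    simp only [a, W]
    rw [hcut n hn, output_append, output_append, List.length_append]
  have hτ : ∀ n ≥ m₀, ∀ k < (T.output (s n) head ++ T.output (q n) (zeros (M n + S))).length,
      (T.output (s n) head ++ T.output (q n) (zeros (M n + S)))[k]? = some (τ (a n + k)) := by
    intro n hn k hk
    have h1 : cut (fun n => n ^ 2) S n ++ (head ++ zeros (M n + S)) =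
        seqPrefix (blockSeq fun n => n ^ 2) (blockPos (fun n => n ^ 2) (n + 2)) := by
      rw [← blockPrefix_eq_seqPrefix, ← cut_append (fun n => n ^ 2) (show S ≤ (n + 1) ^ 2 from ?_),
        hcut n hn, zeros_add]
      · simp only [List.append_assoc]
      · have := hM' n hn
        omega
    rw [← output_append] at hk ⊢
    exact hT.getElem?_output h1 hk
  have hτW : ∀ n ≥ m₀, ∀ k < (W n).length, (W n)[k]? = some (τ (a n + k)) := by
    intro n hn k hk
    have h1 : T.output (s n) head ++ T.output (q n) (zeros (M n + S)) =
        W n ++ T.output (T.run (q n) (zeros (M n))) (zeros S) := by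
      rw [output_zeros_add, ← List.append_assoc]
    have h2 := hτ n hn k
    rw [h1, List.length_append, List.getElem?_append_left hk] at h2
    exact h2 (by omega)
  obtain ⟨n₀, b, hb, hn₀, hsN⟩ : ∃ n₀ b, 0 < b ∧ m₀ ≤ n₀ ∧ ∀ n ≥ n₀, s (n + Z * b) = s n := by
    have : NeZero Z := ⟨hZ.ne'⟩
    -- The residue of the index modulo `Z` is recorded with the state, so that the two runs of zeros
    -- differ by a multiple of `Z` and determinism propagates the coincidence.
    obtain ⟨i, j, hne, hij⟩ := Finite.exists_ne_map_eq_of_infinite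
      fun n => (s (m₀ + n), Fin.ofNat Z n)
    wlog hlt : i < j generalizing i j
    · exact this j i hne.symm hij.symm (by omega)
    rw [Prod.ext_iff] at hij
    have h1 : i % Z = j % Z := congrArg Fin.val hij.2
    obtain ⟨b, hb⟩ := (Nat.modEq_iff_dvd' hlt.le).1 h1
    refine ⟨m₀ + i, b, ?_, by omega, fun n hn => ?_⟩
    · rw [Nat.pos_iff_ne_zero]
      rintro rfl
      omega
    · induction n, hn using Nat.le_induction with
      | base => rw [← hb, show m₀ + i + (j - i) = m₀ + j by omega]; exact hij.1.symm
      | succ n hn ih =>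
        rw [show n + 1 + Z * b = n + Z * b + 1 by omega, hs _ (by omega), hs _ (by omega),
          hMb b n (by omega)]
        simp only [q]
        rw [ih]
        exact run_zeros_cycle_add (hq n) _ _
  have hqN : ∀ n ≥ n₀, q (n + Z * b) = q n := fun n hn => by simp only [q]; rw [hsN n hn]
  refine ultimatelyPeriodic_or_transducible_squares (a := a) (h := fun n => (W n).length)
    (γ := fun n => c (q n)) (N := Z * b) (L := L) (X := X) (n₀ := n₀) (ν := b)
    (Nat.mul_pos hZ hb) hL hb (hT.unbounded_cut S) (fun n hn => ha n (by omega))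
    (fun n hn k hk => ?_) (fun n hn => ?_) (fun n hn => ?_) (fun n hn hc => ?_)
    fun n hn k hXk hk => ?_
  · have hW : W (n + Z * b) = W n ++
        T.output (T.run (q n) (zeros (M n))) (zeros (Z * (b * (2 * (n + 1) + Z * b)))) := by
      simp only [W]
      rw [hsN n hn, hqN n hn, hMb b n (by omega), Nat.add_comm (Z * _), output_zeros_add, List.append_assoc]
    have h1 := hτW n (by omega) k hk
    have h2 := hτW (n + Z * b) (by omega) k (by rw [hW, List.length_append]; omega)
    rw [hW, List.getElem?_append_left hk, h1] at h2
    exact Option.some.inj h2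
  · simp only [W, c, List.length_append]
    rw [hsN n hn, hqN n hn, hMb b n (by omega), length_output_zeros_cycle_add (hq n)]
    ring
  · simp only [hqN n hn]
  · have h1 := T.length_output_zeros_mono (q n) (show Z * n ≤ M n by
      have := hM n (by omega)
      simp only [M]
      omega)
    rw [length_output_zeros_cycle (hq n)] at h1
    have h2 : n ≤ n * c (q n) := Nat.le_mul_of_pos_right _ hc
    simp only [W, List.length_append]
    exact (h2.trans h1).trans (Nat.le_add_left _ _)
  · obtain ⟨x, rfl⟩ := Nat.exists_eq_add_of_le ((hX (s n)).trans hXk)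
    have hx : x < (T.output (q n) (zeros (M n))).length := by
      simp only [W, List.length_append] at hk
      omega
    -- A silent cycle emits nothing after the head, so no position at or beyond `X` would exist.
    have hc : 0 < c (q n) := by
      rw [Nat.pos_iff_ne_zero]
      intro h0
      have h1 := T.length_output_zeros_mono (q n) (Nat.le_mul_of_pos_left (M n) hZ)
      rw [length_output_zeros_cycle (hq n), show (T.output (q n) (zeros Z)).length = 0 from h0]
        at h1
      omega
    have hV : x + L < (T.output (q n) (zeros (M n + S))).length := by
      rw [Nat.add_comm (M n), length_output_zeros_cycle_add (hq n)]
      have : L ≤ L * c (q n) := Nat.le_mul_of_pos_right _ hc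
      simp only [c] at this
      omega
    have h1 := hτ n (by omega) ((T.output (s n) head).length + x)
      (by rw [List.length_append]; omega)
    have h2 := hτ n (by omega) ((T.output (s n) head).length + (x + L))
      (by rw [List.length_append]; omega)
    rw [List.getElem?_append_right (by omega), Nat.add_sub_cancel_left] at h1 h2
    rw [getElem?_output_zeros_cycle (hq n) (hcL _ hc) hV, h1] at h2
    rw [Nat.add_assoc, Nat.add_assoc]
    exact (Option.some.inj h2).symm

end FST

/-! ### The atom -/

theorem mainTheorem1 :
    IsAtom (fstDegree (blockSeq fun n => n ^ 2)) ∧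
    fstDegree (blockSeq fun n => n ^ 2) ≠ ⊥ ∧
    (∀ τ : ℕ → Bool, Transducible (blockSeq fun n => n ^ 2) τ → ¬ UltimatelyPeriodic τ →
      Transducible τ (blockSeq fun n => n ^ 2)) := by
  have h1 : fstDegree (blockSeq fun n => n ^ 2) ≠ ⊥ := by
    rw [Ne, fstDegree_eq_bot_iff]
    exact not_ultimatelyPeriodic_blockSeq fun m => ⟨m, le_rfl, Nat.le_self_pow two_ne_zero m⟩
  have h2 : ∀ τ : ℕ → Bool, Transducible (blockSeq fun n => n ^ 2) τ → ¬ UltimatelyPeriodic τ →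
      Transducible τ (blockSeq fun n => n ^ 2) :=
    fun τ ⟨_, hT⟩ hτ => hT.squares.resolve_left hτ
  refine ⟨⟨h1, fun d hd => ?_⟩, h1, h2⟩
  induction d using Quotient.inductionOn with
  | h τ =>
    change fstDegree τ < _ at hd
    change fstDegree τ = ⊥
    rw [fstDegree_eq_bot_iff]
    by_contra hτ
    exact hd.not_ge (h2 τ hd.le hτ)
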